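/- **Setting.** A *matchbox manifold* of dimension $n$ is a compact connected metrizable space $M$ such that, for some compact metric space $X_0$, each $x\in M$ has an open neighborhood with a homeomorphism $\varphi$ onto $(-2,2)^n\times T$, where $T\subset X_0$ is compact and totally disconnected and $\varphi(x)=(0,w)$ with $w$ in the interior of $T$. A *regular covering* of $M$ with transversal $X$ (a compact totally disconnected metric space) consists of a finite decomposition $X=T_1\sqcup\dots\sqcup T_\nu$ into clopen sets and homeomorphisms $\widehat\varphi_i:\widehat U_i\to(-2,2)^n\times T_i$ with $\widehat U_i\subset M$ open, such that the sets $U_i=\widehat\varphi_i^{-1}((-1,1)^n\times T_i)$ cover $M$ and, with $\pi_i:U_i\to T_i$ the projection, whose fibers are the *plaques* of $U_i$: each plaque of $U_i$ meets at most one plaque of $U_j$, and $D_{i,j}=\pi_i(U_i\cap U_j)$ is closed (hence clopen), for all $i,j$. Then there are homeomorphisms $h_{j,i}:D_{i,j}\to D_{j,i}$ with $h_{j,i}(\pi_i(z))=\pi_j(z)$ for $z\in U_i\cap U_j$. The holonomy pseudo$\star$group $\mathcal G^*$ consists of all restrictions to open sets of the compositions $h_{i_\alpha,i_{\alpha-1}}\circ\dots\circ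 h_{i_1,i_0}$ on their maximal domains. It is *equicontinuous* if for all $\epsilon>0$ there is $\delta>0$ such that $d(w,w')<\delta$ implies $d(g(w),g(w'))<\epsilon$, for all $g\in\mathcal G^*$ and all $w,w'$ in the domain of $g$. An *equicontinuous matchbox manifold* is one whose holonomy pseudo$\star$group, for the chosen regular covering, is equicontinuous. For $U\subset X$, let $\mathcal H_U\subset \mathrm{Homeo}(U)$ be the group generated by the homeomorphisms of $U$ that are restrictions to $U$ of elements of $\mathcal G^*$ whose domain contains $U$. A nonempty clopen set $U$ is *adapted* if each $g\in\mathcal G^*$ that maps some point of $U$ into $U$ agrees, at all points of $U$ in its domain, with a homeomorphism of $U$ that is the restriction to $U$ of an element of $\mathcal G^*$ whose domain contains $U$. Let $\overline{\mathcal H_U}$ be the closure of $\mathcal H_U$ in $\mathrm{Homeo}(U)$ in the uniform topology. *Stable.* $M$ is stable if each $x\in X$ lies in an adapted set $U$ such that for every adapted $V\subset U$ the restriction homomorphism $\{\hat g\in\overline{\mathcal H_U}\mid \hat g(V)=V\}\to\mathrm{Homeo}(V)$ has trivial kernel. *Asymptotic discriminant.* An adapted neighborhood basis at $x\in X$ is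 a descending sequence $U_1\supset U_2\supset\cdots$ of adapted sets with $\bigcap_\ell U_\ell=\{x\}$. Put $\mathcal I_\ell=\{\hat g\in\overline{\mathcal H_{U_\ell}}\mid \hat g(x)=x\}$. Restriction to $U_{\ell+1}$ gives homomorphisms $\sigma_\ell:\mathcal I_\ell\to\mathcal I_{\ell+1}$; the asymptotic discriminant is the tail equivalence class of the sequence $\{\sigma_\ell\}_{\ell\ge1}$. Two sequences of surjective group homomorphisms $\{\phi_i:A_i\to A_{i+1}\}_{i\ge1}$ and $\{\psi_i:B_i\to B_{i+1}\}_{i\ge1}$ are *tail equivalent* if there are strictly increasing sequences of indices $p_i,q_i\ge1$, a sequence of surjective homomorphisms $\tau_i:C_i\to C_{i+1}$ and isomorphisms $a_i:A_{p_i}\to C_{2i-1}$, $b_i:B_{q_i}\to C_{2i}$ such that, for all $i\geq 1$, $\tau_{2i}\circ\tau_{2i-1}\circ a_i=a_{i+1}\circ(\phi_{p_{i+1}-1}\circ\dots\circ\phi_{p_i})$ and $\tau_{2i+1}\circ\tau_{2i}\circ b_i=b_{i+1}\circ(\psi_{q_{i+1}-1}\circ\dots\circ\psi_{q_i})$. A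 sequence is *asymptotically constant* if it is tail equivalent to a sequence of isomorphisms. **Statement.** Let $M$ be an equicontinuous matchbox manifold, with a chosen regular covering with transversal $X$. Then each $x\in X$ has an adapted neighborhood basis. For every $x\in X$ and every adapted neighborhood basis at $x$, all of the homomorphisms $\sigma_\ell$ are surjective, and $M$ is stable if and only if the sequence $\{\sigma_\ell\}$ is asymptotically constant, that is, if and only if the asymptotic discriminant of $M$ is asymptotically constant. -/

import Mathlib

open Set Topology

namespace Matchbox

universe u v

/-! ### Pseudogroup actions -/

/-- The generating data of a finitely generated pseudogroup action on `X`: a finite clopen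
decomposition of `X` into the sets `tile ⁻¹' {i}`, and for each pair `(i, j)` a homeomorphism
`h i j` from a clopen subset of the `i`-th piece onto a clopen subset of the `j`-th piece
(with empty domain if `(i, j)` is not admissible), where `h j i` is the inverse of `h i j`,
and `h i i` is the identity of the `i`-th piece. -/
structure PseudogroupAction (X : Type v) [TopologicalSpace X] where
  ι : Type
  finite_index : Finite ι
  tile : X → ι
  tile_locallyConstant : IsLocallyConstant tile
  h : ι → ι → OpenPartialHomeomorph X X
  isClopen_source : ∀ i j, IsClopen (h i j).source
  source_subset : ∀ i j, (h i j).source ⊆ tile ⁻¹' {i}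
  h_symm : ∀ i j, (h i j).symm ≈ h j i
  source_self : ∀ i, (h i i).source = tile ⁻¹' {i}
  h_self : ∀ i, ∀ x ∈ (h i i).source, h i i x = x

namespace PseudogroupAction

section Words

variable {X : Type v} [TopologicalSpace X] (G : PseudogroupAction.{v} X)

/-- `G.word i₀ [i₁, …, i_α]` is the composition `h_{i_α, i_{α-1}} ∘ ⋯ ∘ h_{i₁, i₀}`, on its
maximal domain of definition. -/
def word : G.ι → List G.ι → OpenPartialHomeomorph X X
  | i, [] => G.h i i
  | i, j :: l => (G.h i j).trans (word j l)

/-- The pseudo-star-group: all restrictions of the maps `word i l` to open subsets of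
their domains. -/
def pseudoStar : Set (OpenPartialHomeomorph X X) :=
  {g | ∃ i l, g.source ⊆ (G.word i l).source ∧ EqOn g (G.word i l) g.source}

/-- The homeomorphism `φ` of `U` is the restriction to `U` of an element of the
pseudo-star-group whose domain contains `U`. -/
def Realizes (U : Set X) (φ : U ≃ₜ U) : Prop :=
  ∃ i l, ∀ u : U, (u : X) ∈ (G.word i l).source ∧ G.word i l u = φ u

/-- The group `H_U` of homeomorphisms of `U` induced by the pseudo-star-group. (If some
element of the pseudo-star-group is the identity of `U` then the homeomorphisms realized by the
pseudo-star-group form a group already, so that nothing is added by passing to the generated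
subgroup.) -/
def holonomyGroup (U : Set X) : Subgroup (U ≃ₜ U) :=
  Subgroup.closure {φ | G.Realizes U φ}

/-- A nonempty clopen set `U` is adapted if the pseudo-star-group is induced by the group `H_U`
on `U`: every element `g` of the pseudo-star-group that takes some point of `U` to a point
of `U` coincides, on all of the points of `U` in its domain, with a homeomorphism of `U` which
is realized by the pseudo-star-group. -/
structure IsAdapted (U : Set X) : Prop where
  isClopen : IsClopen U
  nonempty : U.Nonempty
  induced : ∀ g ∈ G.pseudoStar, (∃ x ∈ U ∩ g.source, g x ∈ U) →
    ∃ φ : U ≃ₜ U, G.Realizes U φ ∧ ∀ u : U, (u : X) ∈ g.source → g u = φ u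

lemma source_word_subset (i : G.ι) (l : List G.ι) : (G.word i l).source ⊆ G.tile ⁻¹' {i} := by
  cases l with
  | nil => exact G.source_subset i i
  | cons j l =>
    intro x hx
    rw [word, OpenPartialHomeomorph.trans_source] at hx
    exact G.source_subset i j hx.1

lemma word_append (i : G.ι) (l : List G.ι) (j : G.ι) (m : List G.ι) (x : X)
    (hx : x ∈ (G.word i l).source) (hy : G.word i l x ∈ (G.word j m).source) :
    x ∈ (G.word i (l ++ m)).source ∧ G.word i (l ++ m) x = G.word j m (G.word i l x) := by
  induction l generalizing i x with
  | nil =>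
    have hi : G.tile x = i := G.source_subset i i hx
    have h1 : G.word i [] x = x := G.h_self i x hx
    rw [h1] at hy ⊢
    have hj : G.tile x = j := G.source_word_subset j m hy
    subst hi
    subst hj
    exact ⟨hy, rfl⟩
  | cons k l ih =>
    simp only [word, OpenPartialHomeomorph.trans_source, mem_inter_iff, mem_preimage] at hx
    obtain ⟨h1, h2⟩ := ih k (G.h i k x) hx.2 hy
    exact ⟨by
      simp only [List.cons_append, word, OpenPartialHomeomorph.trans_source, mem_inter_iff,
        mem_preimage]
      exact ⟨hx.1, h1⟩, h2⟩

lemma exists_inverse_word (i : G.ι) (l : List G.ι) : ∃ j m, ∀ x ∈ (G.word i l).source,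
    G.word i l x ∈ (G.word j m).source ∧ G.word j m (G.word i l x) = x := by
  induction l generalizing i with
  | nil =>
    refine ⟨i, [], fun x hx => ?_⟩
    have h1 : G.word i [] x = x := G.h_self i x hx
    rw [h1]
    exact ⟨hx, h1⟩
  | cons k l ih =>
    obtain ⟨j, m, hjm⟩ := ih k
    refine ⟨j, m ++ [i], fun x hx => ?_⟩
    simp only [word, OpenPartialHomeomorph.trans_source, mem_inter_iff, mem_preimage] at hx
    obtain ⟨h1, h2⟩ := hjm _ hx.2
    have hs := G.h_symm i k
    have h3 : G.h i k x ∈ (G.h k i).source := by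
      rw [← hs.1]
      exact (G.h i k).map_source hx.1
    have h4 : G.h k i (G.h i k x) = x := by
      rw [← hs.2 ((G.h i k).map_source hx.1)]
      exact (G.h i k).left_inv hx.1
    have h5 : x ∈ (G.h i i).source := by
      rw [G.source_self]
      exact G.source_subset i k hx.1
    have h6 : G.word k l (G.h i k x) ∈ (G.word j m).source := h1
    have h7 : G.word j m (G.word k l (G.h i k x)) ∈ (G.word k [i]).source := by
      rw [h2]
      simp only [word, OpenPartialHomeomorph.trans_source, mem_inter_iff, mem_preimage]
      exact ⟨h3, by rw [h4]; exact h5⟩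
    obtain ⟨h8, h9⟩ := G.word_append j m k [i] _ h6 h7
    refine ⟨h8, h9.trans ?_⟩
    rw [h2]
    change G.h i i (G.h k i (G.h i k x)) = x
    rw [h4]
    exact G.h_self i x h5

lemma Realizes.mul {U : Set X} {φ ψ : U ≃ₜ U} (hφ : G.Realizes U φ)
    (hψ : G.Realizes U ψ) : G.Realizes U (φ * ψ) := by
  obtain ⟨i, l, hl⟩ := hφ
  obtain ⟨j, m, hm⟩ := hψ
  refine ⟨j, m ++ l, fun u => ?_⟩
  obtain ⟨h1, h2⟩ := G.word_append j m i l u (hm u).1 (by rw [(hm u).2]; exact (hl _).1)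
  exact ⟨h1, by rw [h2, (hm u).2, (hl _).2]; rfl⟩

lemma Realizes.inv {U : Set X} {φ : U ≃ₜ U} (hφ : G.Realizes U φ) : G.Realizes U φ⁻¹ := by
  obtain ⟨i, l, hl⟩ := hφ
  obtain ⟨j, m, hjm⟩ := G.exists_inverse_word i l
  refine ⟨j, m, fun u => ?_⟩
  have h := hjm _ (hl (φ⁻¹ u)).1
  have e : φ (φ⁻¹ u) = u := φ.apply_symm_apply u
  rw [(hl _).2, e] at h
  exact h

lemma IsAdapted.realizes_one {U : Set X} (hU : G.IsAdapted U) : G.Realizes U 1 := by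
  obtain ⟨x, hx⟩ := hU.nonempty
  have hs : x ∈ (G.h (G.tile x) (G.tile x)).source := by
    rw [G.source_self]
    rfl
  obtain ⟨φ, hφ, -⟩ := hU.induced (G.h (G.tile x) (G.tile x))
    ⟨G.tile x, [], Subset.rfl, fun _ _ => rfl⟩
    ⟨x, ⟨hx, hs⟩, by rw [G.h_self _ _ hs]; exact hx⟩
  have := Realizes.mul G hφ (Realizes.inv G hφ)
  rwa [mul_inv_cancel] at this

lemma IsAdapted.mem_holonomyGroup {U : Set X} (hU : G.IsAdapted U) {φ : U ≃ₜ U} :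
    φ ∈ G.holonomyGroup U ↔ G.Realizes U φ := by
  refine ⟨fun h => ?_, fun h => Subgroup.subset_closure h⟩
  induction h using Subgroup.closure_induction with
  | mem x hx => exact hx
  | one => exact hU.realizes_one
  | mul x y _ _ hx hy => exact Realizes.mul G hx hy
  | inv x _ hx => exact Realizes.inv G hx

lemma IsAdapted.exists_restriction {U V : Set X} (hU : G.IsAdapted U) (hV : G.IsAdapted V)
    (hVU : V ⊆ U) {φ : U ≃ₜ U} (hφ : φ ∈ G.holonomyGroup U) (v : U) (hv : (v : X) ∈ V)
    (hφv : (φ v : X) ∈ V) :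
    ∃ ψ ∈ G.holonomyGroup V, ∀ y : V, (φ ⟨y, hVU y.2⟩ : X) = ψ y := by
  obtain ⟨i, l, hl⟩ := hU.mem_holonomyGroup.1 hφ
  obtain ⟨ψ, hψ, h⟩ := hV.induced (G.word i l) ⟨i, l, Subset.rfl, fun _ _ => rfl⟩
    ⟨v, ⟨hv, (hl v).1⟩, by rw [(hl v).2]; exact hφv⟩
  refine ⟨ψ, hV.mem_holonomyGroup.2 hψ, fun y => ?_⟩
  rw [← h y (hl ⟨y, hVU y.2⟩).1]
  exact (hl ⟨y, hVU y.2⟩).2.symm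

end Words

end PseudogroupAction

/-! ### Closures in the uniform topology, and restrictions -/

/-- The closure, in the uniform topology, of a group of homeomorphisms of a compact
metric space. -/
def uniformClosure {K : Type v} [MetricSpace K] [CompactSpace K] (H : Subgroup (K ≃ₜ K)) :
    Subgroup (K ≃ₜ K) where
  carrier := {g | ∀ ε > 0, ∃ f ∈ H, ∀ x, dist (g x) (f x) < ε}
  one_mem' := fun ε hε => ⟨1, H.one_mem, fun x => by simpa using hε⟩
  mul_mem' := by
    intro a b ha hb ε hε
    have hc : UniformContinuous a := CompactSpace.uniformContinuous_of_continuous a.continuous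
    obtain ⟨δ, hδ, hδa⟩ := Metric.uniformContinuous_iff.1 hc (ε / 2) (half_pos hε)
    obtain ⟨f, hf, hfa⟩ := ha (ε / 2) (half_pos hε)
    obtain ⟨k, hk, hkb⟩ := hb δ hδ
    refine ⟨f * k, H.mul_mem hf hk, fun x => ?_⟩
    calc dist (a (b x)) (f (k x)) ≤ dist (a (b x)) (a (k x)) + dist (a (k x)) (f (k x)) :=
          dist_triangle _ _ _
      _ < ε / 2 + ε / 2 := add_lt_add (hδa (hkb x)) (hfa _)
      _ = ε := add_halves ε
  inv_mem' := by
    intro a ha ε hε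
    have hc : UniformContinuous a.symm :=
      CompactSpace.uniformContinuous_of_continuous a.symm.continuous
    obtain ⟨δ, hδ, hδa⟩ := Metric.uniformContinuous_iff.1 hc ε hε
    obtain ⟨f, hf, hfa⟩ := ha δ hδ
    refine ⟨f⁻¹, H.inv_mem hf, fun x => ?_⟩
    have h := hδa (hfa (f.symm x))
    rw [a.symm_apply_apply, f.apply_symm_apply, dist_comm] at h
    exact h

/-- The group of homeomorphisms `g` of `U` with `g (U ∩ V) = U ∩ V`. -/
def setStabilizer {X : Type v} [TopologicalSpace X] (U V : Set X) : Subgroup (U ≃ₜ U) where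
  carrier := {g | ∀ x : U, (g x : X) ∈ V ↔ (x : X) ∈ V}
  one_mem' := fun _ => Iff.rfl
  mul_mem' := fun {a b} ha hb x => (ha (b x)).trans (hb x)
  inv_mem' := fun {a} ha x => by
    have h := ha (a.symm x)
    rw [a.apply_symm_apply] at h
    exact h.symm

/-- Restriction to `V ⊆ U` of the homeomorphisms of `U` that map `V` onto `V`. -/
def restrictHom {X : Type v} [TopologicalSpace X] {U V : Set X} (hVU : V ⊆ U) :
    setStabilizer U V →* (V ≃ₜ V) where
  toFun g :=
    { toFun := fun x => ⟨(g : U ≃ₜ U) ⟨x, hVU x.2⟩, (g.2 _).2 x.2⟩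
      invFun := fun x => ⟨(g⁻¹ : setStabilizer U V).1 ⟨x, hVU x.2⟩, ((g⁻¹).2 _).2 x.2⟩
      left_inv := fun x => by
        have h := congrArg (Subtype.val : U → X)
          ((g : U ≃ₜ U).symm_apply_apply ⟨x, hVU x.2⟩)
        exact Subtype.ext h
      right_inv := fun x => by
        have h := congrArg (Subtype.val : U → X)
          ((g : U ≃ₜ U).apply_symm_apply ⟨x, hVU x.2⟩)
        exact Subtype.ext h
      continuous_toFun := by
        refine Continuous.subtype_mk ?_ _
        exact continuous_subtype_val.comp ((g : U ≃ₜ U).continuous.comp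
          (continuous_subtype_val.subtype_mk _))
      continuous_invFun := by
        refine Continuous.subtype_mk ?_ _
        exact continuous_subtype_val.comp ((g⁻¹ : setStabilizer U V).1.continuous.comp
          (continuous_subtype_val.subtype_mk _)) }
  map_one' := rfl
  map_mul' := fun _ _ => rfl

lemma exists_separation {X : Type v} [MetricSpace X] [CompactSpace X] {V : Set X}
    (hV : IsClopen V) : ∃ ε > 0, ∀ x ∈ V, ∀ y, dist y x < ε → y ∈ V := by
  obtain ⟨δ, hδ, h⟩ := hV.isClosed.isCompact.exists_thickening_subset_open hV.isOpen Subset.rfl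
  exact ⟨δ, hδ, fun x hx y hy => h (Metric.mem_thickening_iff.2 ⟨x, hx, hy⟩)⟩

/-! ### Sequences of group homomorphisms and tail equivalence -/

/-- A sequence of group homomorphisms `A 0 → A 1 → A 2 → ⋯`. -/
structure HomSeq where
  A : ℕ → Type u
  [group : ∀ i, Group (A i)]
  φ : ∀ i, A i →* A (i + 1)

namespace HomSeq

attribute [instance] HomSeq.group

/-- The composition `φ (j - 1) ∘ ⋯ ∘ φ i : A i → A j`, for `i ≤ j`. -/
def map (S : HomSeq.{u}) {i j : ℕ} (hij : i ≤ j) : S.A i →* S.A j :=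
  Nat.leRec (motive := fun k _ => S.A i →* S.A k) (MonoidHom.id _)
    (fun k _ f => (S.φ k).comp f) hij

/-- All the homomorphisms of the sequence are surjective. -/
def IsSurjective (S : HomSeq.{u}) : Prop := ∀ i, Function.Surjective (S.φ i)

/-- Tail equivalence: subsequences of the two sequences are intertwined, through isomorphisms
`A (p i) ≅ C (2i)` and `B (q i) ≅ C (2i+1)`, in one sequence `C` of surjective homomorphisms. -/
def TailEquiv (S T : HomSeq.{u}) : Prop :=
  ∃ (p q : ℕ → ℕ) (C : HomSeq.{u})
    (a : ∀ i, S.A (p i) ≃* C.A (2 * i)) (b : ∀ i, T.A (q i) ≃* C.A (2 * i + 1))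
    (hp : StrictMono p) (hq : StrictMono q), C.IsSurjective ∧
    (∀ i x, C.map (show 2 * i ≤ 2 * (i + 1) by omega) (a i x) =
      a (i + 1) (S.map (hp i.lt_succ_self).le x)) ∧
    (∀ i x, C.map (show 2 * i + 1 ≤ 2 * (i + 1) + 1 by omega) (b i x) =
      b (i + 1) (T.map (hq i.lt_succ_self).le x))

/-- A sequence is constant if all of its homomorphisms are isomorphisms. -/
def IsConstant (S : HomSeq.{u}) : Prop := ∀ i, Function.Bijective (S.φ i)

/-- A sequence is asymptotically constant if it is tail equivalent to a constant sequence. -/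
def IsAsymptoticallyConstant (S : HomSeq.{u}) : Prop :=
  ∃ T : HomSeq.{u}, T.IsConstant ∧ S.TailEquiv T

end HomSeq

/-! ### Stability and the asymptotic discriminant of a pseudogroup action -/

namespace PseudogroupAction

variable {X : Type v} [MetricSpace X] [CompactSpace X] (G : PseudogroupAction.{v} X)

/-- Equicontinuity of the pseudogroup action. -/
def IsEquicontinuous : Prop :=
  ∀ ε > 0, ∃ δ > 0, ∀ g ∈ G.pseudoStar, ∀ x ∈ g.source, ∀ y ∈ g.source,
    dist x y < δ → dist (g x) (g y) < ε

/-- The closure of the group `H_U` in the uniform topology, for `U` clopen. -/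
def closedHolonomyGroup {U : Set X} (hU : IsClopen U) : Subgroup (U ≃ₜ U) :=
  haveI : CompactSpace U := isCompact_iff_compactSpace.1 hU.isClosed.isCompact
  uniformClosure (G.holonomyGroup U)

lemma mem_closedHolonomyGroup {U : Set X} (hU : IsClopen U) {g : U ≃ₜ U} :
    g ∈ G.closedHolonomyGroup hU ↔
      ∀ ε > 0, ∃ f ∈ G.holonomyGroup U, ∀ x, dist (g x) (f x) < ε :=
  Iff.rfl

/-- The restriction homomorphism to `V ⊆ U` from the group of those elements of the closure
of `H_U` that map `V` onto `V`; this group is the closure of `H_{U,V} = {h ∈ H_U | h V = V}`,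
as `V` is clopen. -/
def closedRestriction {U V : Set X} (hU : IsClopen U) (hVU : V ⊆ U) :
    ↥(G.closedHolonomyGroup hU ⊓ setStabilizer U V) →* (V ≃ₜ V) :=
  (restrictHom hVU).comp (Subgroup.inclusion inf_le_right)

/-- The action is stable if each point is in an adapted clopen set `U` such that, for all adapted
clopen sets `V ⊆ U`, the restriction homomorphism on closures has trivial kernel. -/
def IsStable : Prop :=
  ∀ x : X, ∃ (U : Set X) (hU : G.IsAdapted U), x ∈ U ∧
    ∀ (V : Set X) (_ : G.IsAdapted V) (hVU : V ⊆ U),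
      (G.closedRestriction hU.isClopen hVU).ker = ⊥

/-- An adapted neighborhood basis at `x`. -/
structure AdaptedNhdBasis (x : X) where
  U : ℕ → Set X
  adapted : ∀ l, G.IsAdapted (U l)
  mem : ∀ l, x ∈ U l
  succ_subset : ∀ l, U (l + 1) ⊆ U l
  iInter_eq : ⋂ l, U l = {x}

/-- The isotropy group at `x` of the action on `U` of the closure of `H_U`. -/
def discriminant {U : Set X} (hU : IsClopen U) (x : U) : Subgroup (U ≃ₜ U) where
  carrier := {g | g ∈ G.closedHolonomyGroup hU ∧ g x = x}
  one_mem' := ⟨one_mem _, rfl⟩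
  mul_mem' := fun {a b} ha hb => ⟨mul_mem ha.1 hb.1, by
    change a (b x) = x
    rw [hb.2, ha.2]⟩
  inv_mem' := fun {a} ha => ⟨inv_mem ha.1, a.symm_apply_eq.2 ha.2.symm⟩

variable {G}

lemma discriminant_le_setStabilizer {U V : Set X} (hU : G.IsAdapted U) (hV : G.IsAdapted V)
    (hVU : V ⊆ U) {x : X} (hx : x ∈ V) :
    G.discriminant hU.isClopen ⟨x, hVU hx⟩ ≤ setStabilizer U V := by
  rintro g ⟨hg, hgx⟩ u
  obtain ⟨ε, hε, hs⟩ := exists_separation hV.isClopen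
  obtain ⟨f, hf, hgf⟩ := (G.mem_closedHolonomyGroup hU.isClopen).1 hg ε hε
  have hgf' : ∀ y : U, dist (g y : X) (f y) < ε := hgf
  have hfx : (f ⟨x, hVU hx⟩ : X) ∈ V := by
    refine hs x hx _ ?_
    have h := hgf' ⟨x, hVU hx⟩
    rw [hgx, dist_comm] at h
    exact h
  obtain ⟨ψ, -, hψ⟩ := hU.exists_restriction G hV hVU hf ⟨x, hVU hx⟩ hx hfx
  constructor
  · intro h
    have h1 : (f u : X) ∈ V := hs _ h _ (by rw [dist_comm]; exact hgf' u)
    have h2 : f ⟨ψ.symm ⟨f u, h1⟩, hVU (ψ.symm ⟨f u, h1⟩).2⟩ = f u := by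
      apply Subtype.ext
      rw [hψ, ψ.apply_symm_apply]
    rw [← f.injective h2]
    exact (ψ.symm ⟨f u, h1⟩).2
  · intro h
    have h1 : (f u : X) ∈ V := by
      have h2 := hψ ⟨u, h⟩
      rw [show (f u : X) = ψ ⟨u, h⟩ from h2]
      exact (ψ ⟨u, h⟩).2
    exact hs _ h1 _ (hgf' u)

lemma restrictHom_mem_discriminant {U V : Set X} (hU : G.IsAdapted U) (hV : G.IsAdapted V)
    (hVU : V ⊆ U) {x : X} (hx : x ∈ V) (g : U ≃ₜ U)
    (hg : g ∈ G.discriminant hU.isClopen ⟨x, hVU hx⟩) :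
    restrictHom hVU ⟨g, discriminant_le_setStabilizer hU hV hVU hx hg⟩ ∈
      G.discriminant hV.isClopen ⟨x, hx⟩ := by
  have hgx : (g ⟨x, hVU hx⟩ : X) = x := congrArg Subtype.val hg.2
  refine ⟨(G.mem_closedHolonomyGroup hV.isClopen).2 fun ε hε => ?_, Subtype.ext hgx⟩
  obtain ⟨δ, hδ, hs⟩ := exists_separation hV.isClopen
  obtain ⟨f, hf, hgf⟩ := (G.mem_closedHolonomyGroup hU.isClopen).1 hg.1 (min ε δ) (lt_min hε hδ)
  have hgf' : ∀ y : U, dist (g y : X) (f y) < min ε δ := hgf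
  have hfx : (f ⟨x, hVU hx⟩ : X) ∈ V := by
    refine hs x hx _ ?_
    have h := hgf' ⟨x, hVU hx⟩
    rw [hgx, dist_comm] at h
    exact h.trans_le (min_le_right _ _)
  obtain ⟨ψ, hψ, h⟩ := hU.exists_restriction G hV hVU hf ⟨x, hVU hx⟩ hx hfx
  refine ⟨ψ, hψ, fun y => ?_⟩
  change dist (g ⟨y, hVU y.2⟩ : X) (ψ y) < ε
  rw [← h y]
  exact (hgf' _).trans_le (min_le_left _ _)

/-- Restriction to `V ⊆ U`, as a homomorphism between the isotropy groups at `x ∈ V`, for adapted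
sets `U` and `V`. -/
def discriminantMap {U V : Set X} (hU : G.IsAdapted U) (hV : G.IsAdapted V)
    (hVU : V ⊆ U) {x : X} (hx : x ∈ V) :
    G.discriminant hU.isClopen ⟨x, hVU hx⟩ →* G.discriminant hV.isClopen ⟨x, hx⟩ :=
  ((restrictHom hVU).comp
    (Subgroup.inclusion (discriminant_le_setStabilizer hU hV hVU hx))).codRestrict _
      fun g => restrictHom_mem_discriminant hU hV hVU hx g g.2

/-- The sequence of isotropy groups and restriction homomorphisms of an adapted neighborhood basis.
Its tail equivalence class is the asymptotic discriminant. -/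
def AdaptedNhdBasis.discriminantSeq {x : X} (B : G.AdaptedNhdBasis x) : HomSeq.{v} where
  A l := G.discriminant (B.adapted l).isClopen ⟨x, B.mem l⟩
  φ l := discriminantMap (B.adapted l) (B.adapted (l + 1)) (B.succ_subset l) (B.mem (l + 1))

end PseudogroupAction

/-! ### Matchbox manifolds and their holonomy pseudogroups -/

/-- The open cube `(-r, r)^n`. -/
def cube (n : ℕ) (r : ℝ) : Set (Fin n → ℝ) := {v | ∀ k, |v k| < r}

/-- `M` is a matchbox manifold of dimension `n`: a compact connected metrizable space with a compact
metric space `X` such that each `x : M` is the center `(0, w)` of a chart, that is, a homeomorphism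
from an open set in `M` onto `(-2, 2)^n × T`, where `T ⊆ X` is compact and totally disconnected
and `w` is an interior point of `T`. (Its restriction to the preimage of `(-1, 1)^n × T` is a chart
that extends to a homeomorphism of the closure with `[-1, 1]^n × T`, and further.) -/
structure IsMatchboxManifold (n : ℕ) (M : Type u) [TopologicalSpace M] : Prop where
  compact : CompactSpace M
  connected : ConnectedSpace M
  metrizable : TopologicalSpace.MetrizableSpace M
  exists_chart : ∃ (X : Type u) (_ : MetricSpace X) (_ : CompactSpace X), ∀ x : M,
    ∃ (T : Set X) (φ : OpenPartialHomeomorph M ((Fin n → ℝ) × T)) (w : T),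
      IsCompact T ∧ IsTotallyDisconnected T ∧ (w : X) ∈ interior T ∧
      φ.target = cube n 2 ×ˢ univ ∧ x ∈ φ.source ∧ φ x = (0, w)

/-- A regular foliated covering of `M` with transversal `X`: a finite clopen decomposition of `X`
into sets `T i = tile ⁻¹' {i}`, and homeomorphisms `chart i` from open subsets of `M` onto
`(-2, 2)^n × T i`, such that the domains `U i` of their restrictions to the preimages of
`(-1, 1)^n × T i` cover `M`, each plaque of `U i` meets at most one plaque of `U j`, and the set of
the plaques of `U i` that meet `U j` is closed (hence clopen). -/
structure RegularCovering (n : ℕ) (M : Type u) (X : Type v) [TopologicalSpace M]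
    [TopologicalSpace X] where
  ι : Type
  finite_index : Finite ι
  tile : X → ι
  tile_locallyConstant : IsLocallyConstant tile
  chart : ι → OpenPartialHomeomorph M ((Fin n → ℝ) × X)
  chart_target : ∀ i, (chart i).target = cube n 2 ×ˢ (tile ⁻¹' {i})
  covers : ∀ z : M, ∃ i, z ∈ (chart i).source ∧ (chart i z).1 ∈ cube n 1
  plaque_unique : ∀ i j, ∀ z ∈ (chart i).source ∩ (chart j).source,
    ∀ z' ∈ (chart i).source ∩ (chart j).source,
    (chart i z).1 ∈ cube n 1 → (chart j z).1 ∈ cube n 1 →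
    (chart i z').1 ∈ cube n 1 → (chart j z').1 ∈ cube n 1 →
    (chart i z).2 = (chart i z').2 → (chart j z).2 = (chart j z').2
  isClosed_overlap : ∀ i j, IsClosed {x : X | ∃ z ∈ (chart i).source ∩ (chart j).source,
    (chart i z).1 ∈ cube n 1 ∧ (chart j z).1 ∈ cube n 1 ∧ (chart i z).2 = x}

lemma isOpen_cube (n : ℕ) (r : ℝ) : IsOpen (cube n r) := by
  have h : cube n r = ⋂ k, {v : Fin n → ℝ | |v k| < r} := by
    ext v
    simp [cube]
  rw [h]
  exact isOpen_iInter_of_finite fun k => isOpen_lt (by fun_prop) continuous_const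

namespace RegularCovering

variable {n : ℕ} {M : Type u} {X : Type v} [TopologicalSpace M] [TopologicalSpace X]
  (C : RegularCovering.{u, v} n M X)

/-- The set `U i`, on which `chart i` takes values in `(-1, 1)^n × T i`. -/
def domain (i : C.ι) : Set M := (C.chart i).source ∩ C.chart i ⁻¹' (cube n 1 ×ˢ univ)

/-- The projection of `U i` to the transversal, the fibers of which are the plaques of `U i`. -/
def proj (i : C.ι) (z : M) : X := (C.chart i z).2

/-- The set `D i j` of the plaques of `U i` that meet `U j`. -/
def overlap (i j : C.ι) : Set X := C.proj i '' (C.domain i ∩ C.domain j)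

open Classical in
/-- The transverse change of coordinates `D i j → D j i`: the plaque of `U i` with parameter `x` is
sent to the plaque of `U j` that it meets (and it is the identity outside of `D i j`). -/
noncomputable def transition (i j : C.ι) (x : X) : X :=
  if hx : x ∈ C.overlap i j then C.proj j hx.choose else x

lemma transition_proj {i j : C.ι} {z : M} (hz : z ∈ C.domain i ∩ C.domain j) :
    C.transition i j (C.proj i z) = C.proj j z := by
  have hx : C.proj i z ∈ C.overlap i j := ⟨z, hz, rfl⟩
  rw [transition, dif_pos hx]
  have h := hx.choose_spec
  exact C.plaque_unique i j _ ⟨h.1.1.1, h.1.2.1⟩ z ⟨hz.1.1, hz.2.1⟩ h.1.1.2.1 h.1.2.2.1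
    hz.1.2.1 hz.2.2.1 h.2

lemma isOpen_domain (i : C.ι) : IsOpen (C.domain i) :=
  (C.chart i).isOpen_inter_preimage ((isOpen_cube n 1).prod isOpen_univ)

lemma tile_proj {i : C.ι} {z : M} (hz : z ∈ C.domain i) : C.tile (C.proj i z) = i := by
  have h := (C.chart i).map_source hz.1
  rw [C.chart_target] at h
  exact h.2

/-- Near a point of `D i j` there is a continuous section of the projection with values
in `U i ∩ U j`. -/
lemma exists_section {i j : C.ι} {z : M} (hz : z ∈ C.domain i ∩ C.domain j) :
    ∃ s : X → M, ContinuousAt s (C.proj i z) ∧ s (C.proj i z) = z ∧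
      ∀ᶠ x in 𝓝 (C.proj i z), s x ∈ C.domain i ∩ C.domain j ∧ C.proj i (s x) = x := by
  set a := (C.chart i z).1 with ha
  have hzt : ((a, C.proj i z) : (Fin n → ℝ) × X) ∈ (C.chart i).target :=
    (C.chart i).map_source hz.1.1
  have hs : ContinuousAt (fun x : X => (C.chart i).symm (a, x)) (C.proj i z) :=
    ContinuousAt.comp (f := fun x : X => (a, x)) ((C.chart i).symm.continuousAt hzt)
      (by fun_prop)
  have hsz : (C.chart i).symm (a, C.proj i z) = z := (C.chart i).left_inv hz.1.1
  refine ⟨fun x => (C.chart i).symm (a, x), hs, hsz, ?_⟩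
  have h1 : ∀ᶠ x in 𝓝 (C.proj i z), (C.chart i).symm (a, x) ∈ C.domain i ∩ C.domain j := by
    refine hs.eventually_mem (IsOpen.mem_nhds ((C.isOpen_domain i).inter (C.isOpen_domain j)) ?_)
    rw [hsz]
    exact hz
  have h2 : ∀ᶠ x in 𝓝 (C.proj i z), ((a, x) : (Fin n → ℝ) × X) ∈ (C.chart i).target :=
    ContinuousAt.eventually_mem (f := fun x : X => ((a, x) : (Fin n → ℝ) × X)) (by fun_prop)
      ((C.chart i).open_target.mem_nhds hzt)
  filter_upwards [h1, h2] with x hx1 hx2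
  exact ⟨hx1, by rw [proj, (C.chart i).right_inv hx2]⟩

lemma isOpen_overlap (i j : C.ι) : IsOpen (C.overlap i j) := by
  rw [isOpen_iff_mem_nhds]
  rintro _ ⟨z, hz, rfl⟩
  obtain ⟨s, -, -, h⟩ := C.exists_section hz
  filter_upwards [h] with x hx
  exact ⟨s x, hx⟩

lemma continuousOn_transition (i j : C.ι) :
    ContinuousOn (C.transition i j) (C.overlap i j) := by
  rintro _ ⟨z, hz, rfl⟩
  obtain ⟨s, hs, hsz, h⟩ := C.exists_section hz
  refine ContinuousAt.continuousWithinAt ?_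
  have hc : ContinuousAt (fun x => C.proj j (s x)) (C.proj i z) := by
    refine ContinuousAt.comp (f := s) (g := C.proj j) ?_ hs
    rw [hsz]
    exact continuous_snd.continuousAt.comp ((C.chart j).continuousAt hz.2.1)
  refine hc.congr ?_
  filter_upwards [h] with x hx
  have h1 := C.transition_proj hx.1
  rw [hx.2] at h1
  exact h1.symm

lemma transition_mapsTo {i j : C.ι} {x : X} (hx : x ∈ C.overlap i j) :
    C.transition i j x ∈ C.overlap j i := by
  obtain ⟨z, hz, rfl⟩ := hx
  rw [C.transition_proj hz]
  exact ⟨z, hz.symm, rfl⟩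

lemma transition_transition {i j : C.ι} {x : X} (hx : x ∈ C.overlap i j) :
    C.transition j i (C.transition i j x) = x := by
  obtain ⟨z, hz, rfl⟩ := hx
  rw [C.transition_proj hz, C.transition_proj hz.symm]

/-- The transverse change of coordinates, as a homeomorphism from `D i j` onto `D j i`. -/
noncomputable def transitionHomeo (i j : C.ι) : OpenPartialHomeomorph X X where
  toFun := C.transition i j
  invFun := C.transition j i
  source := C.overlap i j
  target := C.overlap j i
  map_source' _ hx := C.transition_mapsTo hx
  map_target' _ hx := C.transition_mapsTo hx
  left_inv' _ hx := C.transition_transition hx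
  right_inv' _ hx := C.transition_transition hx
  open_source := C.isOpen_overlap i j
  open_target := C.isOpen_overlap j i
  continuousOn_toFun := C.continuousOn_transition i j
  continuousOn_invFun := C.continuousOn_transition j i

lemma overlap_eq (i j : C.ι) : C.overlap i j =
    {x : X | ∃ z ∈ (C.chart i).source ∩ (C.chart j).source,
      (C.chart i z).1 ∈ cube n 1 ∧ (C.chart j z).1 ∈ cube n 1 ∧ (C.chart i z).2 = x} := by
  ext x
  constructor
  · rintro ⟨z, hz, rfl⟩
    exact ⟨z, ⟨hz.1.1, hz.2.1⟩, hz.1.2.1, hz.2.2.1, rfl⟩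
  · rintro ⟨z, hz, h1, h2, rfl⟩
    exact ⟨z, ⟨⟨hz.1, h1, mem_univ _⟩, ⟨hz.2, h2, mem_univ _⟩⟩, rfl⟩

lemma overlap_self (i : C.ι) : C.overlap i i = C.tile ⁻¹' {i} := by
  ext x
  constructor
  · rintro ⟨z, hz, rfl⟩
    exact C.tile_proj hz.1
  · intro hx
    have ht : ((0, x) : (Fin n → ℝ) × X) ∈ (C.chart i).target := by
      rw [C.chart_target]
      exact ⟨fun k => by simp, hx⟩
    have hr := (C.chart i).right_inv ht
    have hz : (C.chart i).symm (0, x) ∈ C.domain i :=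
      ⟨(C.chart i).map_target ht, by
        rw [mem_preimage, hr]
        exact ⟨fun k => by simp, mem_univ _⟩⟩
    exact ⟨_, ⟨hz, hz⟩, by rw [proj, hr]⟩

/-- The holonomy pseudogroup of the covering, acting on the transversal `X`. -/
noncomputable def holonomy : PseudogroupAction.{v} X where
  ι := C.ι
  finite_index := C.finite_index
  tile := C.tile
  tile_locallyConstant := C.tile_locallyConstant
  h := C.transitionHomeo
  isClopen_source i j := by
    refine ⟨?_, C.isOpen_overlap i j⟩
    change IsClosed (C.overlap i j)
    rw [overlap_eq]
    exact C.isClosed_overlap i j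
  source_subset i j := by
    rintro _ ⟨z, hz, rfl⟩
    exact C.tile_proj hz.1
  h_symm _ _ := ⟨rfl, fun _ _ => rfl⟩
  source_self i := C.overlap_self i
  h_self i := by
    rintro _ ⟨z, hz, rfl⟩
    exact C.transition_proj hz

end RegularCovering
end Matchbox

/-! For surjective homomorphisms, asymptotic constancy means injectivity from some index on
(`IsSurjective.isAsymptoticallyConstant_iff`), so stability is to be compared with eventual
injectivity of the restrictions between isotropy groups.

Equicontinuity gives the domains of all words a common inner radius (`exists_mem_source`).
Itineraries relative to a clopen set are therefore locally constant, and their fibers are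
arbitrarily small adapted sets (`exists_isAdapted`). An Arzelà–Ascoli argument (`exists_tendsto`)
extends elements of the closure of `H_V` to the closure of `H_U`, even after transport of `V` into
`U` by a word (`exists_extension`); surjectivity of the restrictions follows.

If the action is stable, an isotropy element over a small basis set extends to the set `U` provided
by stability at `x`; if it is trivial on the next basis set, then its extension is the identity.
Conversely, if the restrictions are injective from `L` on, an element of the closure of `H_{U_L}`
that is the identity near `x` is the identity. Connectedness of `M` makes all orbits dense
(`isMinimal_holonomy`), so conjugation moves this rigidity from `x` to every point of `U_L`
(`eq_one_of_eventually_fixed`), and words into `U_L` move it to every point of `X`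
(`isStable_of_injective`). -/

namespace Matchbox

universe u v

/-! ### Sequences of surjections: asymptotic constancy as eventual injectivity. -/

namespace HomSeq

lemma map_self (S : HomSeq.{u}) (i : ℕ) (x : S.A i) : S.map le_rfl x = x := by
  simp [map, Nat.leRec_self]

lemma map_succ (S : HomSeq.{u}) {i j : ℕ} (hij : i ≤ j) (x : S.A i) :
    S.map (hij.trans j.le_succ) x = S.φ j (S.map hij x) := by
  simp [map, Nat.leRec_succ _ _ hij]

lemma map_map (S : HomSeq.{u}) {i j k : ℕ} (hij : i ≤ j) (hjk : j ≤ k) (x : S.A i) :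
    S.map hjk (S.map hij x) = S.map (hij.trans hjk) x := by
  induction k, hjk using Nat.le_induction with
  | base => rw [map_self]
  | succ k hjk ih => rw [map_succ _ hjk, ih, map_succ _ (hij.trans hjk)]

lemma IsSurjective.map {S : HomSeq.{u}} (hS : S.IsSurjective) {i j : ℕ} (hij : i ≤ j) :
    Function.Surjective (S.map hij) := by
  induction j, hij using Nat.le_induction with
  | base => exact fun y => ⟨y, S.map_self i y⟩
  | succ k hik ih =>
    intro y
    obtain ⟨z, rfl⟩ := hS k y
    obtain ⟨x, rfl⟩ := ih z
    exact ⟨x, S.map_succ hik x⟩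

lemma map_injective {S : HomSeq.{u}} {L : ℕ} (hL : ∀ l, L ≤ l → Function.Injective (S.φ l))
    {i j : ℕ} (hi : L ≤ i) (hij : i ≤ j) : Function.Injective (S.map hij) := by
  induction j, hij using Nat.le_induction with
  | base => exact fun x y h => by rwa [map_self, map_self] at h
  | succ k hik ih =>
    intro x y h
    rw [map_succ _ hik, map_succ _ hik] at h
    exact ih (hL k (hi.trans hik) h)

/-- If a sequence of surjections has a subsequence of injections, then it is eventually
injective. -/
lemma IsSurjective.injective_of_subsequence {S : HomSeq.{u}} (hS : S.IsSurjective) {p : ℕ → ℕ}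
    (hp : StrictMono p)
    (h : ∀ k : ℕ, Function.Injective (S.map (hp k.lt_succ_self).le)) (l : ℕ) (hl : p 0 ≤ l) :
    Function.Injective (S.φ l) := by
  have hinj : ∀ k : ℕ, Function.Injective (S.map (hp.monotone k.zero_le)) := by
    intro k
    induction k with
    | zero => exact fun x y h => by rwa [map_self, map_self] at h
    | succ k ih =>
      intro x y hxy
      rw [← S.map_map (hp.monotone k.zero_le) (hp k.lt_succ_self).le,
        ← S.map_map (hp.monotone k.zero_le) (hp k.lt_succ_self).le] at hxy
      exact ih (h k hxy)
  have hl' : l + 1 ≤ p (l + 1) := hp.id_le _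
  intro a b hab
  -- Lifting to index `p 0` and pushing on to `p (l + 1) ≥ l + 1` places `S.φ l` inside an injective
  -- composite.
  obtain ⟨x, rfl⟩ := hS.map hl a
  obtain ⟨y, rfl⟩ := hS.map hl b
  rw [← map_succ, ← map_succ] at hab
  have h1 := congrArg (S.map hl') hab
  rw [map_map, map_map] at h1
  rw [hinj _ h1]

/-- A sequence of surjections that are eventually injective is asymptotically constant. -/
lemma IsSurjective.isAsymptoticallyConstant {S : HomSeq.{u}} (hS : S.IsSurjective) {L : ℕ}
    (hL : ∀ l, L ≤ l → Function.Injective (S.φ l)) : S.IsAsymptoticallyConstant := by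
  -- The constant sequence at `S.A L` serves both as the constant sequence and as the intertwining
  -- one.
  let T : HomSeq.{u} := { A := fun _ => S.A L, φ := fun _ => MonoidHom.id _ }
  have hT : ∀ {i j : ℕ} (hij : i ≤ j) (x : S.A L), T.map hij x = x := by
    intro i j hij x
    induction j, hij using Nat.le_induction with
    | base => exact T.map_self i x
    | succ k hik ih => exact (T.map_succ hik x).trans ih
  let e : ∀ i, S.A L ≃* S.A (L + i) := fun i => MulEquiv.ofBijective (S.map (Nat.le_add_right L i))
    ⟨map_injective hL le_rfl _, hS.map _⟩
  have hp : StrictMono fun i => L + i := fun a b h => Nat.add_lt_add_left h L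
  refine ⟨T, fun _ => Function.bijective_id, fun i => L + i, id, T, fun i => (e i).symm,
    fun i => MulEquiv.refl _, hp, strictMono_id, fun _ => Function.surjective_id,
    fun i x => ?_, fun i x => ?_⟩
  · obtain ⟨y, rfl⟩ := (e i).surjective x
    refine (hT _ _).trans ?_
    rw [MulEquiv.symm_apply_apply, MulEquiv.eq_symm_apply]
    exact (S.map_map (Nat.le_add_right L i) (hp i.lt_succ_self).le y).symm
  · exact (hT _ _).trans (hT (show i ≤ i + 1 from i.le_succ) x).symm

lemma IsSurjective.exists_injective {S : HomSeq.{u}} (hS : S.IsSurjective)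
    (h : S.IsAsymptoticallyConstant) : ∃ L, ∀ l, L ≤ l → Function.Injective (S.φ l) := by
  obtain ⟨T, hT, p, q, C, a, b, hp, hq, hC, ha, hb⟩ := h
  -- The odd terms of `C` are the terms `q i` of `T`, between which all composites are injective.
  -- Nothing is said about `C.φ 0`.
  have hC1 : ∀ l, 1 ≤ l → Function.Injective (C.φ l) := by
    refine fun l hl => IsSurjective.injective_of_subsequence hC (p := fun k => 2 * k + 1)
      (fun a b h => by dsimp only; omega) (fun i x y hxy => ?_) l hl
    obtain ⟨x, rfl⟩ := (b i).surjective x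
    obtain ⟨y, rfl⟩ := (b i).surjective y
    have hxy' := (hb i x).symm.trans (Eq.trans hxy (hb i y))
    rw [map_injective (L := 0) (fun l _ => (hT l).1) (Nat.zero_le _) _ ((b _).injective hxy')]
  -- The shift avoids `C.φ 0`: the terms `p (k + 1)` of `S` correspond to the even terms of `C` from
  -- `2` on.
  have hp' : StrictMono fun k => p (k + 1) := fun a b h => hp (Nat.succ_lt_succ h)
  refine ⟨p 1, IsSurjective.injective_of_subsequence hS hp' fun i x y hxy => (a (i + 1)).injective ?_⟩
  have hxy' := congrArg (a (i + 2)) hxy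
  rw [← ha (i + 1), ← ha (i + 1)] at hxy'
  exact map_injective hC1 (by omega) _ hxy'

lemma IsSurjective.isAsymptoticallyConstant_iff {S : HomSeq.{u}} (hS : S.IsSurjective) :
    S.IsAsymptoticallyConstant ↔ ∃ L, ∀ l, L ≤ l → Function.Injective (S.φ l) :=
  ⟨hS.exists_injective, fun ⟨_, hL⟩ => hS.isAsymptoticallyConstant hL⟩

end HomSeq

/-- Since the radius is uniform, no point of the complement is `δ`-close to `W`, so the complement
is open too. -/
lemma isClopen_of_forall_dist_lt {X : Type v} [MetricSpace X] {W : Set X} {δ : ℝ} (hδ : 0 < δ)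
    (h : ∀ x ∈ W, ∀ y, dist x y < δ → y ∈ W) : IsClopen W := by
  constructor
  · rw [← isOpen_compl_iff, Metric.isOpen_iff]
    refine fun x hx => ⟨δ, hδ, fun y hy hyW => hx (h y hyW x ?_)⟩
    exact Metric.mem_ball.1 hy
  · rw [Metric.isOpen_iff]
    refine fun x hx => ⟨δ, hδ, fun y hy => h x hx y ?_⟩
    rw [dist_comm]
    exact Metric.mem_ball.1 hy

/-! ### Words, saturations and itineraries. -/

namespace PseudogroupAction

section Words

variable {X : Type v} [TopologicalSpace X] (G : PseudogroupAction.{v} X)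

lemma word_mem_pseudoStar (i : G.ι) (l : List G.ι) : G.word i l ∈ G.pseudoStar :=
  ⟨i, l, Subset.rfl, fun _ _ => rfl⟩

lemma mem_source_word_nil (x : X) : x ∈ (G.word (G.tile x) []).source :=
  (G.source_self (G.tile x)).symm ▸ rfl

lemma word_nil_apply {i : G.ι} {x : X} (hx : x ∈ (G.word i []).source) : G.word i [] x = x :=
  G.h_self i x hx

lemma mem_source_word_cons {i j : G.ι} {l : List G.ι} {x : X} :
    x ∈ (G.word i (j :: l)).source ↔
      x ∈ (G.h i j).source ∧ G.h i j x ∈ (G.word j l).source := by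
  simp [word]

lemma word_singleton {i j : G.ι} {x : X} (hx : x ∈ (G.h i j).source) :
    x ∈ (G.word i [j]).source ∧ G.word i [j] x = G.h i j x := by
  have hj : G.h i j x ∈ (G.word j []).source := by
    change _ ∈ (G.h j j).source
    rw [G.source_self]
    refine G.source_subset j i ?_
    rw [← (G.h_symm i j).1]
    exact (G.h i j).map_source hx
  exact ⟨G.mem_source_word_cons.2 ⟨hx, hj⟩, G.word_nil_apply hj⟩

lemma exists_tile_word (i : G.ι) (l : List G.ι) :
    ∃ j, ∀ x ∈ (G.word i l).source, G.tile (G.word i l x) = j := by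
  induction l generalizing i with
  | nil =>
    refine ⟨i, fun x hx => ?_⟩
    rw [G.word_nil_apply hx]
    exact G.source_word_subset i [] hx
  | cons k l ih =>
    obtain ⟨j, hj⟩ := ih k
    exact ⟨j, fun x hx => hj _ (G.mem_source_word_cons.1 hx).2⟩

/-- In `l ++ m` the word `m` is read from the tile in which `l` ends; `hj` says that this tile is
`j`. -/
lemma mem_source_word_append_iff {i j : G.ι} {l m : List G.ι} {x : X}
    (hx : x ∈ (G.word i l).source) (hj : G.tile (G.word i l x) = j) :
    x ∈ (G.word i (l ++ m)).source ↔ G.word i l x ∈ (G.word j m).source := by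
  refine ⟨fun h => ?_, fun h => (G.word_append i l j m x hx h).1⟩
  induction l generalizing i x with
  | nil =>
    rw [G.word_nil_apply hx] at hj ⊢
    have hi : G.tile x = i := G.source_word_subset i [] hx
    rw [← hj, hi]
    exact h
  | cons k l ih =>
    rw [mem_source_word_cons] at hx
    rw [List.cons_append, mem_source_word_cons] at h
    exact ih hx.2 hj h.2

/-- The points that the pseudo-star-group takes to a point of `U`. -/
def saturation (U : Set X) : Set X :=
  {x | ∃ i l, x ∈ (G.word i l).source ∧ G.word i l x ∈ U}

lemma subset_saturation (U : Set X) : U ⊆ G.saturation U := fun x hx =>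
  ⟨G.tile x, [], G.mem_source_word_nil x, by rwa [G.word_nil_apply (G.mem_source_word_nil x)]⟩

lemma mem_saturation_of_h {U : Set X} {i j : G.ι} {x : X} (hx : x ∈ (G.h i j).source)
    (h : G.h i j x ∈ G.saturation U) : x ∈ G.saturation U := by
  obtain ⟨k, l, hs, hU⟩ := h
  have h1 := G.word_singleton hx
  rw [← h1.2] at hs hU
  have h2 := G.word_append i [j] k l x h1.1 hs
  exact ⟨i, [j] ++ l, h2.1, by rwa [h2.2]⟩

/-- The domains of words that contain `x`, and the words that take `x` into `V`. -/
def itinerary (V : Set X) (x : X) : (i : G.ι) → List G.ι → Prop × Prop :=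
  fun i l => (x ∈ (G.word i l).source, x ∈ (G.word i l).source ∧ G.word i l x ∈ V)

variable {G}

lemma mem_source_iff_of_itinerary_eq {V : Set X} {x y : X}
    (h : G.itinerary V x = G.itinerary V y) (i : G.ι) (l : List G.ι) :
    x ∈ (G.word i l).source ↔ y ∈ (G.word i l).source :=
  iff_of_eq (congrArg Prod.fst (congrFun (congrFun h i) l))

lemma word_mem_iff_of_itinerary_eq {V : Set X} {x y : X}
    (h : G.itinerary V x = G.itinerary V y) (i : G.ι) (l : List G.ι) :
    (x ∈ (G.word i l).source ∧ G.word i l x ∈ V) ↔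
      (y ∈ (G.word i l).source ∧ G.word i l y ∈ V) :=
  iff_of_eq (congrArg Prod.snd (congrFun (congrFun h i) l))

/-- The empty word is the identity of its tile, so an itinerary records membership in `V`. -/
lemma mem_of_itinerary_eq {V : Set X} {x y : X} (h : G.itinerary V x = G.itinerary V y)
    (hx : x ∈ V) : y ∈ V := by
  have hs := G.mem_source_word_nil x
  have h1 := (word_mem_iff_of_itinerary_eq h (G.tile x) []).1
    ⟨hs, by rwa [G.word_nil_apply hs]⟩
  have h2 := h1.2
  rwa [G.word_nil_apply h1.1] at h2

/-- Following `l` by `m` is the word `l ++ m`, so the itinerary of the image can be read off that of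
the point. This equivariance makes itinerary classes adapted. -/
lemma itinerary_word_eq {V : Set X} {x y : X} (h : G.itinerary V x = G.itinerary V y)
    {i : G.ι} {l : List G.ι} (hx : x ∈ (G.word i l).source) :
    G.itinerary V (G.word i l x) = G.itinerary V (G.word i l y) := by
  have hy := (mem_source_iff_of_itinerary_eq h i l).1 hx
  have key : ∀ {x y : X}, G.itinerary V x = G.itinerary V y → x ∈ (G.word i l).source →
      y ∈ (G.word i l).source → ∀ j m, G.word i l x ∈ (G.word j m).source →
      G.word i l y ∈ (G.word j m).source ∧
        (G.word i l x ∈ (G.word j m) ⁻¹' V → G.word i l y ∈ (G.word j m) ⁻¹' V) := by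
    intro x y h hx hy j m hj
    obtain ⟨k, hk⟩ := G.exists_tile_word i l
    obtain rfl : k = j := (hk x hx).symm.trans (G.source_word_subset j m hj)
    have hx1 := G.word_append i l k m x hx hj
    have hy1 := (G.mem_source_word_append_iff hy (hk y hy)).1
      ((mem_source_iff_of_itinerary_eq h i (l ++ m)).1 hx1.1)
    refine ⟨hy1, fun hxV => ?_⟩
    have hy2 := ((word_mem_iff_of_itinerary_eq h i (l ++ m)).1
      ⟨hx1.1, by rw [hx1.2]; exact hxV⟩).2
    rwa [(G.word_append i l k m y hy hy1).2] at hy2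
  funext j m
  refine Prod.ext (propext ⟨fun h1 => ?_, fun h1 => ?_⟩) (propext ⟨fun h1 => ?_, fun h1 => ?_⟩)
  · exact (key h hx hy j m h1).1
  · exact (key h.symm hy hx j m h1).1
  · exact ⟨(key h hx hy j m h1.1).1, (key h hx hy j m h1.1).2 h1.2⟩
  · exact ⟨(key h.symm hy hx j m h1.1).1, (key h.symm hy hx j m h1.1).2 h1.2⟩

end Words

/-! ### Equicontinuity and minimality on adapted sets. -/

section Metric

variable {X : Type v} [MetricSpace X] {G : PseudogroupAction.{v} X}

/-- The elements of `H_U` are uniformly equicontinuous. -/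
lemma IsEquicontinuous.uniformEquicontinuous (hG : G.IsEquicontinuous) {U : Set X}
    (hU : G.IsAdapted U) {ι : Type*} {φ : ι → U ≃ₜ U} (hφ : ∀ n, φ n ∈ G.holonomyGroup U) :
    UniformEquicontinuous fun n y => φ n y := by
  rw [Metric.uniformEquicontinuous_iff]
  intro ε hε
  obtain ⟨δ, hδ, h⟩ := hG ε hε
  refine ⟨δ, hδ, fun y z hyz n => ?_⟩
  obtain ⟨i, l, hl⟩ := hU.mem_holonomyGroup.1 (hφ n)
  have h1 := h _ (G.word_mem_pseudoStar i l) y (hl y).1 z (hl z).1 hyz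
  rwa [(hl y).2, (hl z).2] at h1

/-- The identity of `U` is realized by one word, whose domain lies in a single tile. -/
lemma IsAdapted.exists_eq_word {U : Set X} (hU : G.IsAdapted U) :
    ∃ i, U ⊆ (G.word i []).source := by
  obtain ⟨i, l, h⟩ := hU.realizes_one
  refine ⟨i, fun x hx => ?_⟩
  have h1 := G.mem_source_word_nil x
  rwa [show G.tile x = i from G.source_word_subset i l (h ⟨x, hx⟩).1] at h1

lemma AdaptedNhdBasis.antitone {x : X} (B : G.AdaptedNhdBasis x) : Antitone B.U :=
  antitone_nat_of_succ_le B.succ_subset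

/-- The orbits of the pseudo-star-group are dense. -/
def IsMinimal (G : PseudogroupAction.{v} X) : Prop :=
  ∀ U : Set X, IsOpen U → U.Nonempty → G.saturation U = univ

/-- Minimality gives a word taking `x` into `O`; adaptedness replaces it by a homeomorphism of `U`.
-/
lemma IsMinimal.exists_mem_holonomyGroup (hmin : G.IsMinimal) {U : Set X} (hU : G.IsAdapted U)
    (x : U) {O : Set U} (hO : IsOpen O) (hne : O.Nonempty) : ∃ k ∈ G.holonomyGroup U, k x ∈ O := by
  have hx : (x : X) ∈ G.saturation (Subtype.val '' O) := by
    rw [hmin _ (hU.isClopen.isOpen.isOpenMap_subtype_val O hO) (hne.image _)]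
    trivial
  obtain ⟨i, l, hs, u, hu, hux⟩ := hx
  obtain ⟨φ, hφ, h⟩ := hU.induced _ (G.word_mem_pseudoStar i l)
    ⟨x, ⟨x.2, hs⟩, by rw [← hux]; exact u.2⟩
  refine ⟨φ, hU.mem_holonomyGroup.2 hφ, ?_⟩
  rwa [show φ x = u from Subtype.ext ((h x hs).symm.trans hux.symm)]

/-- As `φ n y` approaches `a`, uniform equicontinuity brings `ψ n a` close to `ψ n (φ n y) = y`. -/
lemma tendsto_inverse_of_uniformEquicontinuous {K ι : Type*} [MetricSpace K] {F : Filter ι}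
    {ψ φ : ι → K → K} (hψ : UniformEquicontinuous ψ) (hinv : ∀ n y, ψ n (φ n y) = y) {y a : K}
    (h : Filter.Tendsto (fun n => φ n y) F (𝓝 a)) :
    Filter.Tendsto (fun n => ψ n a) F (𝓝 y) := by
  rw [Metric.tendsto_nhds] at h ⊢
  intro ε hε
  obtain ⟨δ, hδ, hd⟩ := Metric.uniformEquicontinuous_iff.1 hψ ε hε
  filter_upwards [h δ hδ] with n hn
  rw [dist_comm] at hn
  have := hd _ _ hn n
  rwa [hinv] at this

end Metric

/-! ### Uniform domains and the existence of adapted sets. -/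

variable {X : Type v} [MetricSpace X] [CompactSpace X] {G : PseudogroupAction.{v} X}

/-- The domains of the elements of an equicontinuous action that are compositions of generators
have uniform inner radius. -/
lemma IsEquicontinuous.exists_mem_source (hG : G.IsEquicontinuous) :
    ∃ δ > 0, ∀ i l, ∀ x ∈ (G.word i l).source, ∀ y, dist x y < δ → y ∈ (G.word i l).source := by
  have := G.finite_index
  have h1 : ∀ p : G.ι × G.ι, ∃ ε : Ioi (0 : ℝ), ∀ x ∈ (G.h p.1 p.2).source, ∀ y,
      dist y x < ε → y ∈ (G.h p.1 p.2).source := fun p => by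
    obtain ⟨ε, hε, h⟩ := exists_separation (G.isClopen_source p.1 p.2)
    exact ⟨⟨ε, hε⟩, h⟩
  choose e he using h1
  obtain ⟨⟨ε, hε⟩, hle⟩ := Finite.exists_ge e
  have hsep : ∀ i j, ∀ x ∈ (G.h i j).source, ∀ y, dist x y < ε → y ∈ (G.h i j).source :=
    fun i j x hx y hxy => he (i, j) x hx y (by
      rw [dist_comm]
      exact hxy.trans_le (hle (i, j)))
  obtain ⟨δ, hδ, hequi⟩ := hG ε hε
  -- The prefix `p` already traversed is carried along, so that equicontinuity always applies to one
  -- word from the initial points, and `δ` does not shrink with the length.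
  have key : ∀ x y, dist x y < δ → ∀ (l : List G.ι) (j i : G.ι) (p : List G.ι),
      x ∈ (G.word i p).source → y ∈ (G.word i p).source →
      G.word i p x ∈ (G.word j l).source → G.word i p y ∈ (G.word j l).source := by
    intro x y hxy l
    induction l with
    | nil =>
      intro j i p hx hy h
      exact hsep j j _ h _ (hequi _ (G.word_mem_pseudoStar i p) x hx y hy hxy)
    | cons k l ih =>
      intro j i p hx hy h
      rw [mem_source_word_cons] at h ⊢
      have hy1 := hsep j k _ h.1 _ (hequi _ (G.word_mem_pseudoStar i p) x hx y hy hxy)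
      have hx2 := G.word_singleton h.1
      have hy2 := G.word_singleton hy1
      have hx3 := G.word_append i p j [k] x hx hx2.1
      have hy3 := G.word_append i p j [k] y hy hy2.1
      refine ⟨hy1, ?_⟩
      rw [← hy2.2, ← hy3.2]
      refine ih k i (p ++ [k]) hx3.1 hy3.1 ?_
      rw [hx3.2, hx2.2]
      exact h.2
  -- The bound `ε` keeps `y` in the tile of `x`, where the empty prefix is defined.
  refine ⟨min δ ε, lt_min hδ hε, fun i l x hx y hxy => ?_⟩
  have htx : x ∈ (G.word i []).source := by
    have h := G.mem_source_word_nil x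
    rwa [show G.tile x = i from G.source_word_subset i l hx] at h
  have hty : y ∈ (G.word i []).source := hsep i i x htx y (hxy.trans_le (min_le_right _ _))
  have h := key x y (hxy.trans_le (min_le_left _ _)) l i i [] htx hty
  rw [G.word_nil_apply htx, G.word_nil_apply hty] at h
  exact h hx

/-- Nearby points are taken to points which are simultaneously in or outside of a given clopen
set. -/
lemma IsEquicontinuous.exists_word_mem (hG : G.IsEquicontinuous) {V : Set X} (hV : IsClopen V) :
    ∃ δ > 0, ∀ i l, ∀ x ∈ (G.word i l).source, G.word i l x ∈ V → ∀ y, dist x y < δ →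
      y ∈ (G.word i l).source ∧ G.word i l y ∈ V := by
  obtain ⟨ε, hε, hsep⟩ := exists_separation hV
  obtain ⟨δ₁, hδ₁, h1⟩ := hG.exists_mem_source
  obtain ⟨δ₂, hδ₂, h2⟩ := hG ε hε
  refine ⟨min δ₁ δ₂, lt_min hδ₁ hδ₂, fun i l x hx hxV y hxy => ?_⟩
  have hy := h1 i l x hx y (hxy.trans_le (min_le_left _ _))
  refine ⟨hy, hsep _ hxV _ ?_⟩
  rw [dist_comm]
  exact h2 _ (G.word_mem_pseudoStar i l) x hx y hy (hxy.trans_le (min_le_right _ _))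

lemma IsEquicontinuous.isClopen_saturation (hG : G.IsEquicontinuous) {U : Set X}
    (hU : IsClopen U) : IsClopen (G.saturation U) := by
  obtain ⟨δ, hδ, h⟩ := hG.exists_word_mem hU
  refine isClopen_of_forall_dist_lt hδ ?_
  rintro x ⟨i, l, hx, hxU⟩ y hxy
  exact ⟨i, l, h i l x hx hxU y hxy⟩

lemma IsEquicontinuous.isLocallyConstant_itinerary (hG : G.IsEquicontinuous) {V : Set X}
    (hV : IsClopen V) : IsLocallyConstant (G.itinerary V) := by
  rw [IsLocallyConstant.iff_eventually_eq]
  obtain ⟨δ₁, hδ₁, h1⟩ := hG.exists_mem_source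
  obtain ⟨δ₂, hδ₂, h2⟩ := hG.exists_word_mem hV
  intro x
  filter_upwards [Metric.ball_mem_nhds x (lt_min hδ₁ hδ₂)] with y hy
  have hyx : dist y x < min δ₁ δ₂ := Metric.mem_ball.1 hy
  have hxy : dist x y < min δ₁ δ₂ := by rwa [dist_comm]
  funext i l
  refine Prod.ext (propext ⟨fun h => ?_, fun h => ?_⟩) (propext ⟨fun h => ?_, fun h => ?_⟩)
  · exact h1 i l y h x (hyx.trans_le (min_le_left _ _))
  · exact h1 i l x h y (hxy.trans_le (min_le_left _ _))
  · exact h2 i l y h.1 h.2 x (hyx.trans_le (min_le_right _ _))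
  · exact h2 i l x h.1 h.2 y (hxy.trans_le (min_le_right _ _))

/-- The points with the same itinerary as `x` form an adapted set. -/
lemma IsEquicontinuous.exists_isAdapted (hG : G.IsEquicontinuous) {V : Set X} (hV : IsClopen V)
    {x : X} (hx : x ∈ V) : ∃ U, G.IsAdapted U ∧ x ∈ U ∧ U ⊆ V := by
  set U : Set X := {y | G.itinerary V y = G.itinerary V x} with hU
  have hUU : ∀ {y z : X}, y ∈ U → z ∈ U → G.itinerary V y = G.itinerary V z :=
    fun hy hz => Eq.trans hy (Eq.symm hz)
  refine ⟨U, ⟨(hG.isLocallyConstant_itinerary hV).isClopen_fiber _, ⟨x, rfl⟩, ?_⟩, rfl,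
    fun y hy => mem_of_itinerary_eq (Eq.symm hy) hx⟩
  rintro g ⟨i, l, hgs, hg⟩ ⟨y, ⟨hy, hys⟩, hgy⟩
  obtain ⟨j, m, hinv⟩ := G.exists_inverse_word i l
  rw [hg hys] at hgy
  have hyw := hgs hys
  -- A word taking one point of an itinerary class into the class does so with all of its points.
  -- This is applied to `word i l` and to its inverse word.
  have maps : ∀ {k : G.ι} {p : List G.ι} {a : X}, a ∈ U → a ∈ (G.word k p).source →
      G.word k p a ∈ U → ∀ z ∈ U, z ∈ (G.word k p).source ∧ G.word k p z ∈ U := by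
    intro k p a ha has hpa z hz
    refine ⟨(mem_source_iff_of_itinerary_eq (hUU ha hz) k p).1 has, ?_⟩
    exact (itinerary_word_eq (hUU ha hz) has).symm.trans hpa
  have hw := maps hy hyw hgy
  have hv := maps hgy (hinv y hyw).1 (by rw [(hinv y hyw).2]; exact hy)
  have hwv : ∀ z ∈ U, G.word i l (G.word j m z) = z := by
    intro z hz
    have h1 := (hw _ (hv z hz).2).1
    exact (G.word j m).injOn (hinv _ h1).1 (hv z hz).1 (hinv _ h1).2
  let φ : U ≃ₜ U :=
    { toFun := fun z => ⟨G.word i l z, (hw z z.2).2⟩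
      invFun := fun z => ⟨G.word j m z, (hv z z.2).2⟩
      left_inv := fun z => Subtype.ext (hinv z (hw z z.2).1).2
      right_inv := fun z => Subtype.ext (hwv z z.2)
      continuous_toFun := Continuous.subtype_mk
        ((G.word i l).continuousOn.comp_continuous continuous_subtype_val fun z => (hw z z.2).1) _
      continuous_invFun := Continuous.subtype_mk
        ((G.word j m).continuousOn.comp_continuous continuous_subtype_val
          fun z => (hv z z.2).1) _ }
  exact ⟨φ, ⟨i, l, fun u => ⟨(hw u u.2).1, rfl⟩⟩, fun u hu => hg hu⟩

lemma IsEquicontinuous.nonempty_adaptedNhdBasis [TotallyDisconnectedSpace X]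
    (hG : G.IsEquicontinuous) (x : X) : Nonempty (G.AdaptedNhdBasis x) := by
  have step : ∀ (r : ℝ), 0 < r → ∀ W : Set X, IsClopen W → x ∈ W →
      ∃ U, G.IsAdapted U ∧ x ∈ U ∧ U ⊆ W ∩ Metric.ball x r := by
    intro r hr W hW hx
    obtain ⟨V, hV, hxV, hVW⟩ := compact_exists_isClopen_in_isOpen
      (hW.isOpen.inter Metric.isOpen_ball) ⟨hx, Metric.mem_ball_self hr⟩
    obtain ⟨U, hU, hxU, hUV⟩ := hG.exists_isAdapted hV hxV
    exact ⟨U, hU, hxU, hUV.trans hVW⟩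
  have step' : ∀ (n : ℕ) (W : {W : Set X // G.IsAdapted W ∧ x ∈ W}),
      ∃ U : {U : Set X // G.IsAdapted U ∧ x ∈ U},
        U.1 ⊆ W.1 ∩ Metric.ball x (1 / ((n : ℝ) + 1)) := fun n W => by
    obtain ⟨U, hU, hxU, h⟩ := step _ Nat.one_div_pos_of_nat W.1 W.2.1.isClopen W.2.2
    exact ⟨⟨U, hU, hxU⟩, h⟩
  choose F hF using step'
  obtain ⟨U₀, hU₀, hxU₀⟩ := hG.exists_isAdapted isClopen_univ (mem_univ x)
  let S : ℕ → {W : Set X // G.IsAdapted W ∧ x ∈ W} := fun n =>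
    Nat.rec ⟨U₀, hU₀, hxU₀.1⟩ (fun k W => F k W) n
  refine ⟨⟨fun n => (S n).1, fun n => (S n).2.1, fun n => (S n).2.2,
    fun n => (hF n (S n)).trans inter_subset_left, ?_⟩⟩
  refine Subset.antisymm (fun y hy => ?_) (singleton_subset_iff.2 (mem_iInter.2 fun n => (S n).2.2))
  by_contra hne
  obtain ⟨n, hn⟩ := exists_nat_one_div_lt (dist_pos.2 hne)
  -- Stage `n + 1` lies in the ball of radius `1 / (n + 1)`.
  exact lt_asymm hn ((hF n (S n)).trans inter_subset_right (mem_iInter.1 hy (n + 1)))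

/-! ### Limits in the closures, extension, and surjectivity of restriction. -/

/-- A sequence in `H_U` accumulates at an element of the closure of `H_U`. -/
lemma IsEquicontinuous.exists_tendsto (hG : G.IsEquicontinuous) {U : Set X}
    (hU : G.IsAdapted U) {φ : ℕ → U ≃ₜ U} (hφ : ∀ n, φ n ∈ G.holonomyGroup U) :
    ∃ g ∈ G.closedHolonomyGroup hU.isClopen,
      ∀ y, Filter.Tendsto (fun n => φ n y) (Filter.hyperfilter ℕ) (𝓝 (g y)) := by
  have : CompactSpace U := isCompact_iff_compactSpace.1 hU.isClopen.isClosed.isCompact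
  -- Along one ultrafilter the maps and their inverses converge at all points at once, without
  -- diagonal subsequences.
  have lim : ∀ u : ℕ → U, ∃ a, Filter.Tendsto u (Filter.hyperfilter ℕ) (𝓝 a) := fun u => by
    obtain ⟨a, -, ha⟩ := isCompact_univ.ultrafilter_le_nhds
      (Ultrafilter.map u (Filter.hyperfilter ℕ)) (by simp)
    exact ⟨a, ha⟩
  choose f hf using fun y : U => lim fun n => φ n y
  choose k hk using fun y : U => lim fun n => (φ n).symm y
  have eφ := hG.uniformEquicontinuous hU hφ
  have eψ : UniformEquicontinuous fun n y => (φ n).symm y :=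
    hG.uniformEquicontinuous hU (φ := fun n => (φ n)⁻¹) fun n => inv_mem (hφ n)
  have hfc : Continuous f := (tendsto_pi_nhds.2 hf).continuous_of_equicontinuous eφ.equicontinuous
  have hkc : Continuous k := (tendsto_pi_nhds.2 hk).continuous_of_equicontinuous eψ.equicontinuous
  let g : U ≃ₜ U :=
    { toFun := f
      invFun := k
      left_inv := fun y => tendsto_nhds_unique (hk (f y))
        (tendsto_inverse_of_uniformEquicontinuous eψ (fun n => (φ n).symm_apply_apply) (hf y))
      right_inv := fun y => tendsto_nhds_unique (hf (k y))
        (tendsto_inverse_of_uniformEquicontinuous eφ (fun n => (φ n).apply_symm_apply) (hk y))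
      continuous_toFun := hfc
      continuous_invFun := hkc }
  refine ⟨g, (G.mem_closedHolonomyGroup _).2 fun ε hε => ?_, hf⟩
  -- On a compact space, pointwise convergence of an equicontinuous family is uniform.
  have hu := UniformFun.tendsto_iff_tendstoUniformly.1
    ((eφ.equicontinuous.tendsto_uniformFun_iff_pi _ f).2 (tendsto_pi_nhds.2 hf))
  obtain ⟨n, hn⟩ := (Metric.tendstoUniformly_iff.1 hu ε hε).exists
  exact ⟨φ n, hφ n, hn⟩

/-- Elements of the closure of `H_V`, transported by an element of the pseudo-star-group that takes
`V` into an adapted set `U`, extend to elements of the closure of `H_U`. -/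
lemma IsEquicontinuous.exists_extension (hG : G.IsEquicontinuous) {U V : Set X}
    (hU : G.IsAdapted U) (hV : G.IsAdapted V) {i : G.ι} {l : List G.ι}
    (hs : V ⊆ (G.word i l).source) (hm : MapsTo (G.word i l) V U) {g : V ≃ₜ V}
    (hg : g ∈ G.closedHolonomyGroup hV.isClopen) :
    ∃ φ ∈ G.closedHolonomyGroup hU.isClopen,
      ∀ y : V, (φ ⟨G.word i l y, hm y.2⟩ : X) = G.word i l (g y) := by
  have h1 : ∀ n : ℕ, ∃ f ∈ G.holonomyGroup V, ∀ y, dist (g y) (f y) < 1 / ((n : ℝ) + 1) :=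
    fun n => (G.mem_closedHolonomyGroup _).1 hg _ Nat.one_div_pos_of_nat
  choose f hf hgf using h1
  have h2 : ∀ n, ∃ φ ∈ G.holonomyGroup U,
      ∀ y : V, (φ ⟨G.word i l y, hm y.2⟩ : X) = G.word i l (f n y) := by
    intro n
    obtain ⟨j, m, hinv⟩ := G.exists_inverse_word i l
    obtain ⟨k, p, hp⟩ := hV.mem_holonomyGroup.1 (hf n)
    -- With `w = G.word i l`, the word `m ++ (p ++ l)` is the conjugate `w ∘ f n ∘ w⁻¹` on `w(V)`.
    have key : ∀ y : V, G.word i l y ∈ (G.word j (m ++ (p ++ l))).source ∧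
        G.word j (m ++ (p ++ l)) (G.word i l y) = G.word i l (f n y) := by
      intro y
      have hy := hinv y (hs y.2)
      have a1 := G.word_append k p i l y (hp y).1 (by rw [(hp y).2]; exact hs (f n y).2)
      have a2 := G.word_append j m k (p ++ l) _ hy.1 (by rw [hy.2]; exact a1.1)
      exact ⟨a2.1, by rw [a2.2, hy.2, a1.2, (hp y).2]⟩
    obtain ⟨y₀, hy₀⟩ := hV.nonempty
    obtain ⟨φ, hφ, h⟩ := hU.induced _ (G.word_mem_pseudoStar j (m ++ (p ++ l)))
      ⟨G.word i l y₀, ⟨hm hy₀, (key ⟨y₀, hy₀⟩).1⟩, by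
        rw [(key ⟨y₀, hy₀⟩).2]
        exact hm (f n _).2⟩
    exact ⟨φ, hU.mem_holonomyGroup.2 hφ, fun y => (h _ (key y).1).symm.trans (key y).2⟩
  choose φ hφ hφf using h2
  obtain ⟨ψ, hψ, hlim⟩ := hG.exists_tendsto hU hφ
  refine ⟨ψ, hψ, fun y => ?_⟩
  have hfy : Filter.Tendsto (fun n => (f n y : X)) (Filter.hyperfilter ℕ) (𝓝 (g y)) := by
    refine Filter.Tendsto.mono_left ?_ Nat.hyperfilter_le_atTop
    rw [tendsto_iff_dist_tendsto_zero]
    refine squeeze_zero (fun _ => dist_nonneg) (fun n => ?_) tendsto_one_div_add_atTop_nhds_zero_nat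
    rw [dist_comm]
    exact (hgf n y).le
  have hw := ((G.word i l).continuousAt (hs (g y).2)).tendsto.comp hfy
  have hl := (continuous_subtype_val.tendsto _).comp (hlim ⟨G.word i l y, hm y.2⟩)
  refine tendsto_nhds_unique hl (hw.congr fun n => ?_)
  exact (hφf n y).symm

/-- Restriction of the isotropy groups of the closures is surjective. -/
lemma IsEquicontinuous.discriminantMap_surjective (hG : G.IsEquicontinuous) {U V : Set X}
    (hU : G.IsAdapted U) (hV : G.IsAdapted V) (hVU : V ⊆ U) {x : X} (hx : x ∈ V) :
    Function.Surjective (discriminantMap hU hV hVU hx) := by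
  rintro ⟨g, hg, hgx⟩
  -- The inclusion of `V` in `U` is an empty word, so `exists_extension` applies to it.
  obtain ⟨i, hi⟩ := hV.exists_eq_word
  have hid : ∀ y ∈ V, G.word i [] y = y := fun y hy => G.word_nil_apply (hi hy)
  obtain ⟨φ, hφ, h⟩ := hG.exists_extension hU hV hi
    (fun y hy => by rw [hid y hy]; exact hVU hy) hg
  have h' : ∀ y : V, (φ ⟨y, hVU y.2⟩ : X) = g y := by
    intro y
    have h1 := h y
    rw [hid _ (g y).2] at h1
    rw [← h1]
    congr 2
    exact Subtype.ext (hid y y.2).symm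
  refine ⟨⟨φ, hφ, Subtype.ext ?_⟩, Subtype.ext (Homeomorph.ext fun y => Subtype.ext (h' y))⟩
  rw [h' ⟨x, hx⟩, hgx]

/-! ### Stability and eventual injectivity of the discriminant sequence. -/

lemma AdaptedNhdBasis.isSurjective_discriminantSeq (hG : G.IsEquicontinuous) {x : X}
    (B : G.AdaptedNhdBasis x) : B.discriminantSeq.IsSurjective := fun l =>
  hG.discriminantMap_surjective (B.adapted l) (B.adapted (l + 1)) (B.succ_subset l) (B.mem (l + 1))

lemma AdaptedNhdBasis.exists_subset {x : X} (B : G.AdaptedNhdBasis x) {W : Set X}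
    (hW : W ∈ 𝓝 x) : ∃ L, ∀ l, L ≤ l → B.U l ⊆ W := by
  obtain ⟨L, hL⟩ := exists_subset_nhds_of_isCompact (V := B.U) B.antitone.directed_ge
    (fun l => (B.adapted l).isClopen.isClosed.isCompact) (U := W) (by
      rw [B.iInter_eq]
      rintro y rfl
      exact hW)
  exact ⟨L, fun l hl => (B.antitone hl).trans hL⟩

lemma AdaptedNhdBasis.map_discriminantSeq_apply {x : X} (B : G.AdaptedNhdBasis x) {k l : ℕ}
    (hkl : k ≤ l) (g : G.discriminant (B.adapted k).isClopen ⟨x, B.mem k⟩) (y : B.U l) :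
    ((G.discriminant (B.adapted l).isClopen ⟨x, B.mem l⟩).subtype
      (B.discriminantSeq.map hkl g) y : X) = g.1 ⟨y, B.antitone hkl y.2⟩ := by
  induction l, hkl using Nat.le_induction with
  | base =>
    exact congrArg (fun f : G.discriminant (B.adapted k).isClopen ⟨x, B.mem k⟩ => (f.1 y : X))
      (B.discriminantSeq.map_self k g)
  | succ l hkl ih =>
    exact (congrArg (fun f : G.discriminant (B.adapted (l + 1)).isClopen ⟨x, B.mem (l + 1)⟩ =>
      (f.1 y : X)) (B.discriminantSeq.map_succ hkl g)).trans (ih ⟨y, B.succ_subset l y.2⟩)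

lemma AdaptedNhdBasis.injective_of_isStable (hG : G.IsEquicontinuous) (hst : G.IsStable) {x : X}
    (B : G.AdaptedNhdBasis x) :
    ∃ L, ∀ l, L ≤ l → Function.Injective (B.discriminantSeq.φ l) := by
  obtain ⟨U, hU, hxU, h⟩ := hst x
  obtain ⟨L, hL⟩ := B.exists_subset (hU.isClopen.isOpen.mem_nhds hxU)
  refine ⟨L, fun l hl => (injective_iff_map_eq_one _).2 fun g hg => ?_⟩
  have hlU : B.U (l + 1) ⊆ U := hL _ (hl.trans l.le_succ)
  -- Lifting `g` to the isotropy group over `U` puts it where stability, with `V = B.U (l + 1)`,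
  -- rules out a kernel.
  obtain ⟨φ, rfl⟩ := hG.discriminantMap_surjective hU (B.adapted l) (hL l hl) (B.mem l) g
  have hφ : φ.1 ∈ setStabilizer U (B.U (l + 1)) :=
    discriminant_le_setStabilizer hU (B.adapted (l + 1)) hlU (B.mem (l + 1)) φ.2
  have hker : (⟨φ.1, φ.2.1, hφ⟩ : ↥(G.closedHolonomyGroup hU.isClopen ⊓
      setStabilizer U (B.U (l + 1)))) ∈ (G.closedRestriction hU.isClopen hlU).ker :=
    MonoidHom.mem_ker.2 (congrArg Subtype.val hg)
  rw [h _ (B.adapted (l + 1)) hlU, Subgroup.mem_bot] at hker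
  have hφ1 : φ.1 = 1 := congrArg Subtype.val hker
  have h1 : φ = 1 := Subtype.ext hφ1
  rw [h1, map_one]
  rfl

lemma holonomyGroup_le_closedHolonomyGroup {U : Set X} (hU : IsClopen U) :
    G.holonomyGroup U ≤ G.closedHolonomyGroup hU := fun g hg =>
  (G.mem_closedHolonomyGroup hU).2 fun ε hε => ⟨g, hg, fun x => by rwa [dist_self]⟩

/-- The closure of `H_{U_L}` acts quasi-analytically. Near `x` this is injectivity of the
restrictions, since a neighborhood of `x` contains some basis set; density of orbits carries it to
other points. -/
lemma AdaptedNhdBasis.eq_one_of_eventually_fixed {x : X} (B : G.AdaptedNhdBasis x) {L : ℕ}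
    (hL : ∀ l, L ≤ l → Function.Injective (B.discriminantSeq.φ l)) (hmin : G.IsMinimal)
    {g : B.U L ≃ₜ B.U L} (hg : g ∈ G.closedHolonomyGroup (B.adapted L).isClopen) {v : B.U L}
    (hv : ∀ᶠ u in 𝓝 v, g u = u) : g = 1 := by
  have isotropy : ∀ f ∈ G.closedHolonomyGroup (B.adapted L).isClopen,
      (∀ᶠ u in 𝓝 (⟨x, B.mem L⟩ : B.U L), f u = u) → f = 1 := by
    intro f hf hfx
    obtain ⟨l₀, hl₀⟩ := B.exists_subset
      ((B.adapted L).isClopen.isOpen.isOpenEmbedding_subtypeVal.image_mem_nhds.2 hfx)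
    have hl : L ≤ max L l₀ := le_max_left _ _
    have hfix : ∀ y (hy : y ∈ B.U (max L l₀)), f ⟨y, B.antitone hl hy⟩ = ⟨y, B.antitone hl hy⟩ := by
      intro y hy
      obtain ⟨u, hu, rfl⟩ := hl₀ _ (le_max_right _ _) hy
      exact hu
    let f' : G.discriminant (B.adapted L).isClopen ⟨x, B.mem L⟩ := ⟨f, hf, hfx.self_of_nhds⟩
    have h1 : B.discriminantSeq.map hl f' = 1 := Subtype.ext (Homeomorph.ext fun y => Subtype.ext
      ((B.map_discriminantSeq_apply hl f' y).trans (congrArg Subtype.val (hfix y y.2))))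
    have h2 : f' = 1 := (injective_iff_map_eq_one _).1 (HomSeq.map_injective hL le_rfl hl) f' h1
    exact congrArg Subtype.val h2
  obtain ⟨k, hk, hkO⟩ := hmin.exists_mem_holonomyGroup (B.adapted L) ⟨x, B.mem L⟩
    (isOpen_interior (s := {u | g u = u})) ⟨v, mem_interior_iff_mem_nhds.2 hv⟩
  have hk' := holonomyGroup_le_closedHolonomyGroup (B.adapted L).isClopen hk
  -- As `k` takes `x` into the interior of the fixed set of `g`, this conjugate is the identity near
  -- `x`.
  have h1 : k⁻¹ * g * k = 1 := by
    refine isotropy _ (mul_mem (mul_mem (inv_mem hk') hg) hk') ?_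
    filter_upwards [k.continuous.continuousAt.preimage_mem_nhds (isOpen_interior.mem_nhds hkO)]
      with u hu
    have hgu : g (k u) = k u := interior_subset (s := {u | g u = u}) hu
    change k.symm (g (k u)) = u
    rw [hgu, k.symm_apply_apply]
  have h2 : k⁻¹ * g = k⁻¹ := mul_eq_one_iff_eq_inv.1 h1
  exact mul_eq_left.1 h2

lemma AdaptedNhdBasis.isStable_of_injective [TotallyDisconnectedSpace X] (hG : G.IsEquicontinuous)
    (hmin : G.IsMinimal) {x : X} (B : G.AdaptedNhdBasis x) {L : ℕ}
    (hL : ∀ l, L ≤ l → Function.Injective (B.discriminantSeq.φ l)) : G.IsStable := by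
  intro y
  have hy : y ∈ G.saturation (B.U L) := by
    rw [hmin _ (B.adapted L).isClopen.isOpen (B.adapted L).nonempty]
    trivial
  obtain ⟨i, l, hys, hyU⟩ := hy
  -- The set `U` is taken so small that a single word transports it into `B.U L`.
  obtain ⟨W, hW, hyW, hWs⟩ := compact_exists_isClopen_in_isOpen
    ((G.word i l).isOpen_inter_preimage (B.adapted L).isClopen.isOpen) ⟨hys, hyU⟩
  obtain ⟨U, hU, hyU, hUW⟩ := hG.exists_isAdapted hW hyW
  have hs : U ⊆ (G.word i l).source := fun z hz => (hWs (hUW hz)).1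
  have hm : MapsTo (G.word i l) U (B.U L) := fun z hz => (hWs (hUW hz)).2
  refine ⟨U, hU, hyU, fun V hV hVU => (Subgroup.eq_bot_iff_forall _).2 ?_⟩
  rintro ⟨g, hg, hgV⟩ hker
  have hfix : ∀ z (hz : z ∈ V), (g ⟨z, hVU hz⟩ : X) = z := fun z hz =>
    congrArg (fun f : V ≃ₜ V => (f ⟨z, hz⟩ : X)) (MonoidHom.mem_ker.1 hker)
  obtain ⟨φ, hφ, h⟩ := hG.exists_extension (B.adapted L) hU hs hm hg
  obtain ⟨v, hv⟩ := hV.nonempty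
  -- On the open image of `V` the map `φ` is the transport of `g` restricted to `V`, which is the
  -- identity.
  have hφ1 : φ = 1 := by
    refine B.eq_one_of_eventually_fixed hL hmin hφ (v := ⟨G.word i l v, hm (hVU hv)⟩) ?_
    have hopen : IsOpen (G.word i l '' V) :=
      (G.word i l).isOpen_image_of_subset_source hV.isClopen.isOpen (hVU.trans hs)
    filter_upwards [continuous_subtype_val.continuousAt.preimage_mem_nhds
      (hopen.mem_nhds (mem_image_of_mem _ hv))]
    rintro ⟨_, _⟩ ⟨z, hz, rfl⟩
    exact Subtype.ext ((h ⟨z, hVU hz⟩).trans (congrArg _ (hfix z hz)))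
  refine Subtype.ext (Homeomorph.ext fun z => Subtype.ext ?_)
  refine (G.word i l).injOn (hs (g z).2) (hs z.2) ?_
  rw [← h z, hφ1]
  rfl

end PseudogroupAction

/-! ### Minimality of the holonomy of a connected space. -/

namespace RegularCovering

variable {n : ℕ} {M : Type u} {X : Type v} [TopologicalSpace M]

/-- The holonomy pseudogroup of a connected space is minimal if it is equicontinuous. -/
lemma isMinimal_holonomy [PreconnectedSpace M] [MetricSpace X] [CompactSpace X]
    [TotallyDisconnectedSpace X] (C : RegularCovering.{u, v} n M X)
    (hC : C.holonomy.IsEquicontinuous) : C.holonomy.IsMinimal := by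
  intro O hO hne
  obtain ⟨x₀, hx₀⟩ := hne
  -- Equicontinuity makes the saturation of a clopen set clopen, so `O` is shrunk to such a set.
  obtain ⟨U, hU, hxU, hUO⟩ := compact_exists_isClopen_in_isOpen hO hx₀
  set W := C.holonomy.saturation U with hWdef
  have hW : IsClopen W := hC.isClopen_saturation hU
  have hmono : W ⊆ C.holonomy.saturation O := by
    rintro x ⟨i, l, hs, hx⟩
    exact ⟨i, l, hs, hUO hx⟩
  -- Whether the parameter of `z` lies in `W` does not depend on the chart. Hence `W` and its
  -- complement cut `M` into two disjoint open sets, and connectedness leaves only the first.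
  have hinv : ∀ {i j z}, z ∈ C.domain i ∩ C.domain j → C.proj j z ∈ W → C.proj i z ∈ W := by
    intro i j z hz h
    refine C.holonomy.mem_saturation_of_h (i := i) (j := j) ⟨z, hz, rfl⟩ ?_
    change C.transition i j (C.proj i z) ∈ W
    rwa [C.transition_proj hz]
  have hcov : ∀ z, ∃ i, z ∈ C.domain i := fun z => by
    obtain ⟨i, h1, h2⟩ := C.covers z
    exact ⟨i, h1, h2, trivial⟩
  have hopen : ∀ S : Set X, IsOpen S → IsOpen {z | ∃ i, z ∈ C.domain i ∧ C.proj i z ∈ S} := by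
    intro S hS
    rw [show {z | ∃ i, z ∈ C.domain i ∧ C.proj i z ∈ S} =
      ⋃ i, C.domain i ∩ C.proj i ⁻¹' S by ext z; simp]
    refine isOpen_iUnion fun i => ContinuousOn.isOpen_inter_preimage ?_ (C.isOpen_domain i) hS
    exact continuous_snd.comp_continuousOn ((C.chart i).continuousOn.mono inter_subset_left)
  have hclopen : IsClopen {z | ∃ i, z ∈ C.domain i ∧ C.proj i z ∈ W} := by
    refine ⟨?_, hopen W hW.isOpen⟩
    rw [← isOpen_compl_iff]
    convert hopen Wᶜ hW.compl.isOpen using 1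
    ext z
    constructor
    · intro hz
      obtain ⟨i, hi⟩ := hcov z
      exact ⟨i, hi, fun h => hz ⟨i, hi, h⟩⟩
    · rintro ⟨i, hi, h⟩ ⟨j, hj, h'⟩
      exact h (hinv ⟨hi, hj⟩ h')
  have hlift : ∀ x : X, ∃ i, ∃ z ∈ C.domain i, C.proj i z = x := fun x => by
    have hx : x ∈ C.overlap (C.tile x) (C.tile x) := by
      rw [C.overlap_self]
      rfl
    obtain ⟨z, hz, h⟩ := hx
    exact ⟨_, z, hz.1, h⟩
  have huniv : {z | ∃ i, z ∈ C.domain i ∧ C.proj i z ∈ W} = univ := by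
    obtain ⟨i, z, hz, h⟩ := hlift x₀
    exact hclopen.eq_univ ⟨z, i, hz, by rw [h]; exact C.holonomy.subset_saturation U hxU⟩
  refine eq_univ_of_forall fun x => hmono ?_
  obtain ⟨i, z, hz, rfl⟩ := hlift x
  obtain ⟨j, hj, h⟩ := huniv.symm.subset (mem_univ z)
  exact hinv ⟨hz, hj⟩ h

end RegularCovering
end Matchbox

theorem corollary4p12 {n : ℕ} {M : Type*} [TopologicalSpace M]
    (hM : Matchbox.IsMatchboxManifold n M)
    {X : Type*} [MetricSpace X] [CompactSpace X] [TotallyDisconnectedSpace X]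
    (C : Matchbox.RegularCovering n M X) (hC : C.holonomy.IsEquicontinuous) :
    (∀ x : X, Nonempty (C.holonomy.AdaptedNhdBasis x)) ∧
    ∀ (x : X) (B : C.holonomy.AdaptedNhdBasis x),
      B.discriminantSeq.IsSurjective ∧
      (C.holonomy.IsStable ↔ B.discriminantSeq.IsAsymptoticallyConstant) := by
  have := hM.connected
  refine ⟨fun x => hC.nonempty_adaptedNhdBasis x, fun x B => ?_⟩
  have hB := B.isSurjective_discriminantSeq hC
  refine ⟨hB, ?_⟩
  rw [Matchbox.HomSeq.IsSurjective.isAsymptoticallyConstant_iff hB]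
  exact ⟨fun h => B.injective_of_isStable hC h,
    fun ⟨_, hL⟩ => B.isStable_of_injective hC (C.isMinimal_holonomy hC) hL⟩
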